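/- Let $n \ge 0$ and let $V_n$ be an elementary abelian $2$-group of rank $n$, i.e. an $n$-dimensional vector space over $\mathbb F_2$, with general linear group $\mathrm{GL}(V_n)$. Let $\Gamma_n$ be the subcomplex of the simplex with vertex set $V_n \setminus \{0\}$ whose faces are the nonempty sets of nonzero vectors that do not span $V_n$. Let $\mathcal T(V_n)$ be the Tits building of $V_n$: the simplicial complex whose vertices are the linear subspaces $W$ with $0 \ne W \ne V_n$ and whose simplices are the nonempty sets of such subspaces that are totally ordered by inclusion. The group $\mathrm{GL}(V_n)$ acts simplicially on both complexes, by $v \mapsto g(v)$ and $W \mapsto g(W)$ on vertices, hence on their geometric realizations. Then the $\mathrm{GL}(V_n)$-spaces $|\Gamma_n|$ and $|\mathcal T(V_n)|$ are $\mathrm{GL}(V_n)$-homotopy equivalent: there are continuous $\mathrm{GL}(V_n)$-equivariant maps $f : |\Gamma_n| \to |\mathcal T(V_n)|$ and $h : |\mathcal T(V_n)| \to |\Gamma_n|$ such that $h \circ f$ and $f \circ h$ are homotopic to the respective identity maps through $\mathrm{GL}(V_n)$-equivariant maps. -/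

import Mathlib

/-!
Finite simplicial complexes with a group action, their geometric realizations, equivariant
homotopy equivalence, and the two complexes of a finite vector space that are compared.
-/

namespace TitsBuilding

section Realization

/-- The geometric realization of a finite abstract simplicial complex `K`, in barycentric
coordinates: the functions `x ≥ 0` on the vertices whose support is a face of `K` and whose
values sum to `1`. As there are finitely many vertices, its usual topology is the subspace
topology from `ι → ℝ`. -/
def Realization {ι : Type*} [Finite ι] (K : PreAbstractSimplicialComplex ι) : Type _ :=
  {x : ι → ℝ // (∀ i, 0 ≤ x i) ∧
    ∃ s ∈ K.faces, Function.support x = (s : Set ι) ∧ ∑ i ∈ s, x i = 1}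

instance {ι : Type*} [Finite ι] (K : PreAbstractSimplicialComplex ι) :
    TopologicalSpace (Realization K) :=
  instTopologicalSpaceSubtype

/-- The action of `G` on the vertices sends faces of `K` to faces of `K`. -/
class ActsSimplicially (G : Type*) [Group G] {ι : Type*} [MulAction G ι]
    (K : PreAbstractSimplicialComplex ι) : Prop where
  map_mem : ∀ (g : G) (s : Finset ι), s ∈ K.faces →
    s.map (MulAction.toPerm g).toEmbedding ∈ K.faces

/-- A simplicial action extends affinely to the realization: the vertex `i` goes to `g • i`, so
the barycentric coordinate of `g • x` at `i` is that of `x` at `g⁻¹ • i`. -/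
instance {G : Type*} [Group G] {ι : Type*} [Finite ι] [MulAction G ι]
    (K : PreAbstractSimplicialComplex ι) [ActsSimplicially G K] :
    MulAction G (Realization K) where
  smul g x := ⟨fun i => x.1 (g⁻¹ • i), fun i => x.2.1 _, by
    obtain ⟨s, hs, hsupp, hsum⟩ := x.2.2
    refine ⟨_, ActsSimplicially.map_mem g s hs, ?_, ?_⟩
    · ext i
      have h : x.1 (g⁻¹ • i) ≠ 0 ↔ g⁻¹ • i ∈ s := by
        rw [← Function.mem_support, hsupp, Finset.mem_coe]
      simp only [Function.mem_support, h, Finset.coe_map, Set.mem_image, Finset.mem_coe,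
        Equiv.coe_toEmbedding, MulAction.toPerm_apply]
      constructor
      · intro hi
        exact ⟨_, hi, smul_inv_smul g i⟩
      · rintro ⟨j, hj, rfl⟩
        rwa [inv_smul_smul]
    · simpa [Finset.sum_map] using hsum⟩
  one_smul x := by
    apply Subtype.ext
    funext i
    change x.1 ((1 : G)⁻¹ • i) = x.1 i
    rw [inv_one, one_smul]
  mul_smul g h x := by
    apply Subtype.ext
    funext i
    change x.1 ((g * h)⁻¹ • i) = x.1 (h⁻¹ • g⁻¹ • i)
    rw [mul_inv_rev, mul_smul]

instance {G : Type*} [Group G] {ι : Type*} [Finite ι] [MulAction G ι]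
    (K : PreAbstractSimplicialComplex ι) [ActsSimplicially G K] :
    ContinuousConstSMul G (Realization K) where
  continuous_const_smul g := by
    refine continuous_induced_rng.mpr (continuous_pi fun i => ?_)
    exact (continuous_apply (g⁻¹ • i)).comp continuous_subtype_val

end Realization

section EquivariantHomotopy

/-- The continuous map `f` commutes with the actions of `G`. -/
def IsEquivariant (G : Type*) [Group G] {X Y : Type*} [TopologicalSpace X] [TopologicalSpace Y]
    [MulAction G X] [MulAction G Y] (f : C(X, Y)) : Prop :=
  ∀ (g : G) (x : X), f (g • x) = g • f x

/-- `G`-homotopy equivalence of `G`-spaces: there are `G`-maps `f : X → Y` and `h : Y → X` whose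
two composites are homotopic to the identities through `G`-maps. -/
def EquivariantlyHomotopyEquivalent (G : Type*) [Group G] (X Y : Type*)
    [TopologicalSpace X] [TopologicalSpace Y] [MulAction G X] [MulAction G Y] : Prop :=
  ∃ (f : C(X, Y)) (h : C(Y, X)), IsEquivariant G f ∧ IsEquivariant G h ∧
    (h.comp f).HomotopicWith (ContinuousMap.id X) (IsEquivariant G) ∧
    (f.comp h).HomotopicWith (ContinuousMap.id Y) (IsEquivariant G)

end EquivariantHomotopy

section Complexes

/-- The nonzero vectors of `V`. -/
def NonzeroVector (V : Type*) [AddCommGroup V] : Type _ := {v : V // v ≠ 0}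

/-- The vector underlying a nonzero vector. -/
def NonzeroVector.val {V : Type*} [AddCommGroup V] (v : NonzeroVector V) : V := Subtype.val v

/-- The vertices of the Tits building of `V`: the subspaces `W` with `0 ≠ W ≠ V`. -/
def ProperSubspace (F V : Type*) [Field F] [AddCommGroup V] [Module F V] : Type _ :=
  {W : Submodule F V // W ≠ ⊥ ∧ W ≠ ⊤}

variable (F V : Type*) [Field F] [AddCommGroup V] [Module F V]

instance [Finite V] : Finite (NonzeroVector V) :=
  inferInstanceAs (Finite {v : V // v ≠ 0})

instance [Finite V] : Finite (ProperSubspace F V) :=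
  inferInstanceAs (Finite {W : Submodule F V // W ≠ ⊥ ∧ W ≠ ⊤})

instance : PartialOrder (ProperSubspace F V) :=
  inferInstanceAs (PartialOrder {W : Submodule F V // W ≠ ⊥ ∧ W ≠ ⊤})

/-- `GL(V)` acts on the nonzero vectors by `g • v = g v`. -/
instance : MulAction (LinearMap.GeneralLinearGroup F V) (NonzeroVector V) where
  smul g v := ⟨g.toLinearEquiv v.1, g.toLinearEquiv.map_ne_zero_iff.mpr v.2⟩
  one_smul _ := rfl
  mul_smul _ _ _ := rfl

/-- `GL(V)` acts on the proper nonzero subspaces by `g • W = g(W)`. -/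
instance : MulAction (LinearMap.GeneralLinearGroup F V) (ProperSubspace F V) where
  smul g W := ⟨W.1.map (g.toLinearEquiv : V →ₗ[F] V), by
    constructor
    · simpa [Submodule.map_eq_bot_iff] using W.2.1
    · intro h
      apply W.2.2
      apply Submodule.map_injective_of_injective (f := (g.toLinearEquiv : V →ₗ[F] V))
        g.toLinearEquiv.injective
      rw [h, Submodule.map_top, LinearEquiv.range]⟩
  one_smul W := Subtype.ext (Submodule.map_id W.1)
  mul_smul g h W := Subtype.ext (Submodule.map_comp _ _ W.1)

/-- The subcomplex of the simplex on the nonzero vectors of `V` whose faces are the (nonempty)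
finite sets of nonzero vectors that do not span `V`. -/
def nonSpanningComplex : PreAbstractSimplicialComplex (NonzeroVector V) where
  faces := {s | s.Nonempty ∧ Submodule.span F (NonzeroVector.val '' (s : Set (NonzeroVector V))) ≠ ⊤}
  isRelLowerSet_faces := by
    rintro s ⟨hs, hspan⟩
    refine ⟨hs, fun t hts ht => ⟨ht, fun h => hspan ?_⟩⟩
    exact top_le_iff.mp (h ▸ Submodule.span_mono (Set.image_mono (Finset.coe_subset.mpr hts)))

/-- The Tits building of `V`: vertices are the proper nonzero subspaces of `V`, simplices are the
flags, i.e. the nonempty finite sets of such subspaces that are totally ordered by inclusion. -/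
def building : PreAbstractSimplicialComplex (ProperSubspace F V) where
  faces := {s | s.Nonempty ∧ IsChain (· ≤ ·) (s : Set (ProperSubspace F V))}
  isRelLowerSet_faces := by
    rintro s ⟨hs, hchain⟩
    exact ⟨hs, fun t hts ht => ⟨ht, hchain.mono (Finset.coe_subset.mpr hts)⟩⟩

instance : ActsSimplicially (LinearMap.GeneralLinearGroup F V) (nonSpanningComplex F V) where
  map_mem g s hs := by
    refine ⟨hs.1.map, fun h => hs.2 ?_⟩
    have himg : NonzeroVector.val '' ((s.map (MulAction.toPerm g).toEmbedding : Finset _) :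
          Set (NonzeroVector V)) =
        (g.toLinearEquiv : V →ₗ[F] V) '' (NonzeroVector.val '' (s : Set (NonzeroVector V))) := by
      rw [Finset.coe_map, Set.image_image, Set.image_image]
      rfl
    rw [himg, ← Submodule.map_span] at h
    apply Submodule.map_injective_of_injective (f := (g.toLinearEquiv : V →ₗ[F] V))
      g.toLinearEquiv.injective
    rw [h, Submodule.map_top, LinearEquiv.range]

instance : ActsSimplicially (LinearMap.GeneralLinearGroup F V) (building F V) where
  map_mem g s hs := by
    refine ⟨hs.1.map, ?_⟩
    rw [Finset.coe_map]
    rintro _ ⟨W, hW, rfl⟩ _ ⟨W', hW', rfl⟩ _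
    exact (hs.2.total hW hW').imp (fun h => Submodule.map_mono h) (fun h => Submodule.map_mono h)

end Complexes

end TitsBuilding

/-! Send x in |Γ| to the spans of its superlevel sets. These are nested, and the proper nonzero ones
form a flag. To make this continuous, each subspace W gets the weight `flagWeight x W`, a polynomial
in truncated gaps max(0, x v - x u), nonzero exactly when the vectors of W exceeding every value
outside W span W. Normalizing gives `toBuilding`. In the other direction, `ofBuilding` sends W to
the barycentre of its nonzero vectors. Neither map involves a choice, so both are equivariant.

Each composite shares a face with the identity at every point, so straight segments give equivariant
homotopies (`homotopicWith_of_common_face`). On |Γ| the face is the set of all nonzero vectors in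
the span of the support of x (`le_span_support_of_flagWeight_ne_zero`). On the building, the new
flag and the old one are comparable, so their union is a flag
(`le_or_le_of_flagWeight_averageDistribution_ne_zero`). -/

namespace TitsBuilding

attribute [local instance] Fintype.ofFinite

/-! ### Barycentric coordinates and straight-line homotopies -/

section Realization

variable {ι : Type*} [Finite ι] {K : PreAbstractSimplicialComplex ι}

lemma Realization.sum_eq_one (x : Realization K) : ∑ i, x.1 i = 1 := by
  obtain ⟨s, -, hsupp, hsum⟩ := x.2.2
  refine (Finset.sum_subset (Finset.subset_univ s) fun i _ hi => ?_).symm.trans hsum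
  by_contra h
  exact hi (Finset.mem_coe.mp (hsupp ▸ Function.mem_support.mpr h))

/-- A point of the realization from barycentric coordinates whose support is contained in, but
not necessarily equal to, a face. -/
def Realization.mk (x : ι → ℝ) (h0 : ∀ i, 0 ≤ x i) (h1 : ∑ i, x i = 1)
    (hs : ∃ s ∈ K.faces, ∀ i, x i ≠ 0 → i ∈ s) : Realization K :=
  ⟨x, h0, by
    classical
    obtain ⟨s, hs, hsupp⟩ := hs
    refine ⟨Finset.univ.filter fun i => x i ≠ 0, ?_, by ext; simp, ?_⟩
    · refine (K.isRelLowerSet_faces hs).2 (fun i hi => hsupp i (Finset.mem_filter.mp hi).2) ?_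
      by_contra hne
      rw [Finset.not_nonempty_iff_eq_empty] at hne
      have hz : ∀ i, x i = 0 := fun i => by
        by_contra hi
        exact Finset.notMem_empty i (hne ▸ Finset.mem_filter.mpr ⟨Finset.mem_univ i, hi⟩)
      simp [hz] at h1
    · rw [← h1, Finset.sum_filter_ne_zero]⟩

/-- Maps into a realization that agree up to a common face are homotopic along segments, and the
homotopy is equivariant if the maps are. -/
lemma homotopicWith_of_common_face {G X : Type*} [Group G] [MulAction G ι] [ActsSimplicially G K]
    [TopologicalSpace X] [MulAction G X] (a b : C(X, Realization K))
    (ha : IsEquivariant G a) (hb : IsEquivariant G b)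
    (hab : ∀ x, ∃ s ∈ K.faces, ∀ i, (a x).1 i ≠ 0 ∨ (b x).1 i ≠ 0 → i ∈ s) :
    a.HomotopicWith b (IsEquivariant G) := by
  refine ⟨{
    toFun := fun p => Realization.mk
      (fun i => (1 - (p.1 : ℝ)) * (a p.2).1 i + (p.1 : ℝ) * (b p.2).1 i) ?_ ?_ ?_
    continuous_toFun := ?_
    map_zero_left := ?_
    map_one_left := ?_
    prop' := ?_ }⟩
  · intro i
    exact add_nonneg (mul_nonneg (sub_nonneg.mpr p.1.2.2) ((a p.2).2.1 i))
      (mul_nonneg p.1.2.1 ((b p.2).2.1 i))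
  · rw [Finset.sum_add_distrib, ← Finset.mul_sum, ← Finset.mul_sum, (a p.2).sum_eq_one,
      (b p.2).sum_eq_one]
    ring
  · obtain ⟨s, hs, h⟩ := hab p.2
    refine ⟨s, hs, fun i hi => h i ?_⟩
    by_contra! hc
    simp [hc.1, hc.2] at hi
  · refine continuous_induced_rng.mpr (continuous_pi fun i => ?_)
    have h1 : Continuous fun p : unitInterval × X => (a p.2).1 i :=
      (continuous_apply i).comp (continuous_subtype_val.comp (a.continuous.comp continuous_snd))
    have h2 : Continuous fun p : unitInterval × X => (b p.2).1 i :=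
      (continuous_apply i).comp (continuous_subtype_val.comp (b.continuous.comp continuous_snd))
    have h3 : Continuous fun p : unitInterval × X => (p.1 : ℝ) :=
      continuous_subtype_val.comp continuous_fst
    exact ((continuous_const.sub h3).mul h1).add (h3.mul h2)
  · intro x
    apply Subtype.ext
    funext i
    simp [Realization.mk]
  · intro x
    apply Subtype.ext
    funext i
    simp [Realization.mk]
  · intro t g x
    apply Subtype.ext
    funext i
    change (1 - (t : ℝ)) * (a (g • x)).1 i + (t : ℝ) * (b (g • x)).1 i =
      (1 - (t : ℝ)) * (a x).1 (g⁻¹ • i) + (t : ℝ) * (b x).1 (g⁻¹ • i)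
    rw [ha, hb]
    rfl

end Realization

variable {F V : Type*} [Field F] [AddCommGroup V] [Module F V]

/-- A subspace not contained in `W` has a nonzero vector outside `W`. -/
lemma exists_nonzeroVector_notMem {U W : Submodule F V} (h : ¬U ≤ W) :
    ∃ u : NonzeroVector V, u.val ∈ U ∧ u.val ∉ W := by
  obtain ⟨u, hu, huW⟩ := SetLike.not_le_iff_exists.mp h
  exact ⟨⟨u, fun h0 => huW (h0 ▸ W.zero_mem)⟩, hu, huW⟩

variable [Finite V]

/-! ### Weights detecting spans of superlevel sets -/

section FlagWeight

open Classical in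
/-- A continuous weight which is positive exactly when the proper subspace `W` is spanned by a
superlevel set of `x`. -/
noncomputable def flagWeight (x : NonzeroVector V → ℝ) (W : Submodule F V) : ℝ :=
  ∏ U : Submodule F V, if U < W then
    ∑ v : NonzeroVector V, if v.val ∈ W ∧ v.val ∉ U then
      ∏ u : NonzeroVector V, if u.val ∉ W then max 0 (x v - x u) else 1
    else 0
  else 1

lemma continuous_flagWeight (W : Submodule F V) :
    Continuous fun x : NonzeroVector V → ℝ => flagWeight x W := by
  classical
  unfold flagWeight
  refine continuous_finsetProd _ fun U _ => ?_
  split_ifs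
  · refine continuous_finsetSum _ fun v _ => ?_
    split_ifs
    · refine continuous_finsetProd _ fun u _ => ?_
      split_ifs <;> fun_prop
    · fun_prop
  · fun_prop

lemma prod_gap_nonneg (x : NonzeroVector V → ℝ) (W : Submodule F V) (v : NonzeroVector V)
    [∀ u : NonzeroVector V, Decidable (u.val ∉ W)] :
    0 ≤ ∏ u : NonzeroVector V, if u.val ∉ W then max 0 (x v - x u) else 1 :=
  Finset.prod_nonneg fun u _ => by split_ifs <;> simp

lemma flagWeight_nonneg (x : NonzeroVector V → ℝ) (W : Submodule F V) : 0 ≤ flagWeight x W := by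
  classical
  refine Finset.prod_nonneg fun U _ => ?_
  split_ifs
  · refine Finset.sum_nonneg fun v _ => ?_
    split_ifs
    · exact prod_gap_nonneg x W v
    · exact le_rfl
  · exact zero_le_one

/-- All terms are nonnegative, so sums cannot cancel: the product over U becomes "for all", the sum
over v "there exists". Vectors of W lying in no common proper subspace U of W are those that span W.
-/
lemma flagWeight_ne_zero_iff (x : NonzeroVector V → ℝ) (W : Submodule F V) :
    flagWeight x W ≠ 0 ↔ ∀ U < W, ∃ v : NonzeroVector V, v.val ∈ W ∧ v.val ∉ U ∧
      ∀ u : NonzeroVector V, u.val ∉ W → x u < x v := by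
  classical
  unfold flagWeight
  rw [Finset.prod_ne_zero_iff]
  refine forall_congr' fun U => ?_
  simp only [Finset.mem_univ, true_implies]
  by_cases hU : U < W
  · simp only [hU, if_true, true_implies]
    rw [Ne, Finset.sum_eq_zero_iff_of_nonneg]
    · simp only [Finset.mem_univ, true_implies, not_forall]
      refine exists_congr fun v => ?_
      by_cases hv : v.val ∈ W ∧ v.val ∉ U
      · simp only [hv, not_false_eq_true, and_self, if_true, true_and]
        rw [← Ne, Finset.prod_ne_zero_iff]
        refine forall_congr' fun u => ?_
        by_cases hu : u.val ∈ W
        · simp [hu]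
        · simp [hu]
      · simp only [hv, if_false, not_true_eq_false, false_iff]
        tauto
    · intro v _
      split_ifs
      · exact prod_gap_nonneg x W v
      · exact le_rfl
  · simp [hU]

lemma flagWeight_smul (g : LinearMap.GeneralLinearGroup F V) (x : NonzeroVector V → ℝ)
    (W : Submodule F V) :
    flagWeight (fun v => x (g • v)) W =
      flagWeight x (W.map (g.toLinearEquiv : V →ₗ[F] V)) := by
  classical
  have hmem : ∀ (U : Submodule F V) (v : NonzeroVector V),
      (g • v).val ∈ U.map (g.toLinearEquiv : V →ₗ[F] V) ↔ v.val ∈ U := fun U v =>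
    g.toLinearEquiv.injective.mem_set_image
  unfold flagWeight
  refine Fintype.prod_equiv (Submodule.orderIsoMapComap g.toLinearEquiv).toEquiv _ _ fun U => ?_
  have hlt : U.map (g.toLinearEquiv : V →ₗ[F] V) < W.map (g.toLinearEquiv : V →ₗ[F] V) ↔ U < W :=
    (Submodule.orderIsoMapComap g.toLinearEquiv).lt_iff_lt
  change _ = ite (U.map (g.toLinearEquiv : V →ₗ[F] V) < _) _ _
  simp only [hlt]
  split_ifs
  · refine Fintype.sum_equiv (MulAction.toPerm g) _ _ fun v => ?_
    simp only [MulAction.toPerm_apply]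
    change _ = ite (_ ∧ (g • v).val ∉ U.map (g.toLinearEquiv : V →ₗ[F] V)) _ _
    simp only [hmem]
    split_ifs
    · refine Fintype.prod_equiv (MulAction.toPerm g) _ _ fun u => ?_
      simp only [MulAction.toPerm_apply, hmem]
    · rfl
  · rfl

lemma le_or_le_of_flagWeight_ne_zero {x : NonzeroVector V → ℝ} {W W' : Submodule F V}
    (h : flagWeight x W ≠ 0) (h' : flagWeight x W' ≠ 0) : W ≤ W' ∨ W' ≤ W := by
  rw [flagWeight_ne_zero_iff] at h h'
  by_contra! hc
  -- Testing both against the intersection gives v in W outside W' and v' in W' outside W, each with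
  -- the strictly larger value.
  obtain ⟨v, hv, hvU, hvx⟩ := h (W ⊓ W') (inf_lt_left.mpr hc.1)
  obtain ⟨v', hv', hvU', hvx'⟩ := h' (W ⊓ W') (inf_lt_right.mpr hc.2)
  exact lt_asymm (hvx v' fun hm => hvU' ⟨hm, hv'⟩) (hvx' v fun hm => hvU ⟨hv, hm⟩)

lemma le_span_support_of_flagWeight_ne_zero {x : NonzeroVector V → ℝ} (hx : ∀ v, 0 ≤ x v)
    {W : Submodule F V} (hW : W ≠ ⊤) (h : flagWeight x W ≠ 0) :
    W ≤ Submodule.span F (NonzeroVector.val '' Function.support x) := by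
  rw [flagWeight_ne_zero_iff] at h
  by_contra hc
  obtain ⟨v, hv, hvU, hvx⟩ := h _ (inf_lt_left.mpr hc)
  -- Properness of W supplies some u outside it; then x v > x u ≥ 0 puts v in the support.
  obtain ⟨u, -, hu⟩ := exists_nonzeroVector_notMem (U := ⊤) (fun hle => hW (top_le_iff.mp hle))
  exact hvU ⟨hv, Submodule.subset_span ⟨v, ((hx u).trans_lt (hvx u hu)).ne', rfl⟩⟩

lemma span_support_ne_top (x : Realization (nonSpanningComplex F V)) :
    Submodule.span F (NonzeroVector.val '' Function.support x.1) ≠ ⊤ := by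
  obtain ⟨s, hs, hsupp, -⟩ := x.2.2
  rw [hsupp]
  exact hs.2

/-- The span of the vectors where x is maximal works: it is proper because these vectors lie in the
support. This makes the normalizing denominator of `toBuilding` positive. -/
lemma exists_flagWeight_ne_zero (x : Realization (nonSpanningComplex F V)) :
    ∃ W : ProperSubspace F V, flagWeight x.1 W.1 ≠ 0 := by
  have hpos : ∃ v, 0 < x.1 v := by
    by_contra! hc
    have := x.sum_eq_one
    rw [Finset.sum_eq_zero fun v _ => le_antisymm (hc v) (x.2.1 v)] at this
    exact zero_ne_one this
  obtain ⟨w, hw⟩ := hpos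
  have : Nonempty (NonzeroVector V) := ⟨w⟩
  obtain ⟨m, hm⟩ := Finite.exists_max x.1
  have hm0 : 0 < x.1 m := hw.trans_le (hm w)
  set L : Set (NonzeroVector V) := {v | x.1 v = x.1 m}
  have hmem : ∀ v ∈ L, v.val ∈ Submodule.span F (NonzeroVector.val '' L) := fun v hv =>
    Submodule.subset_span ⟨v, hv, rfl⟩
  refine ⟨⟨Submodule.span F (NonzeroVector.val '' L), fun h => ?_, fun h => ?_⟩, ?_⟩
  · have := hmem m rfl
    rw [h, Submodule.mem_bot] at this
    exact m.2 this
  · refine span_support_ne_top x (top_le_iff.mp (h ▸ Submodule.span_mono (Set.image_mono ?_)))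
    intro v hv
    exact (hm0.trans_eq (Eq.symm hv)).ne'
  · rw [flagWeight_ne_zero_iff]
    intro U hU
    have : ∃ v ∈ L, v.val ∉ U := by
      by_contra! hc
      refine hU.not_ge (Submodule.span_le.mpr ?_)
      rintro _ ⟨v, hv, rfl⟩
      exact hc v hv
    obtain ⟨v, hv, hvU⟩ := this
    refine ⟨v, hmem v hv, hvU, fun u hu => ?_⟩
    have hv' : x.1 v = x.1 m := hv
    rw [hv']
    exact lt_of_le_of_ne (hm u) fun he => hu (hmem u he)

end FlagWeight

/-! ### The two equivariant maps -/

section Maps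

lemma sum_flagWeight_pos (x : Realization (nonSpanningComplex F V)) :
    0 < ∑ W : ProperSubspace F V, flagWeight x.1 W.1 := by
  obtain ⟨W, hW⟩ := exists_flagWeight_ne_zero x
  exact Finset.sum_pos' (fun W _ => flagWeight_nonneg _ _)
    ⟨W, Finset.mem_univ W, (flagWeight_nonneg _ _).lt_of_ne' hW⟩

variable (F V) in
/-- The map sending `x` into the flag of the spans of its superlevel sets. -/
noncomputable def toBuilding :
    C(Realization (nonSpanningComplex F V), Realization (building F V)) where
  toFun x := Realization.mk
    (fun W => flagWeight x.1 W.1 / ∑ W : ProperSubspace F V, flagWeight x.1 W.1)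
    (fun W => div_nonneg (flagWeight_nonneg _ _) (sum_flagWeight_pos x).le)
    (by rw [← Finset.sum_div, div_self (sum_flagWeight_pos x).ne']) <| by
      classical
      obtain ⟨W, hW⟩ := exists_flagWeight_ne_zero x
      refine ⟨Finset.univ.filter fun W => flagWeight x.1 W.1 ≠ 0,
        ⟨⟨W, by simpa using hW⟩, ?_⟩, fun W hW => ?_⟩
      · intro W hW W' hW' _
        exact le_or_le_of_flagWeight_ne_zero (by simpa using hW) (by simpa using hW')
      · simpa using (div_ne_zero_iff.mp hW).1
  continuous_toFun := by
    refine continuous_induced_rng.mpr (continuous_pi fun W => ?_)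
    exact ((continuous_flagWeight _).comp continuous_subtype_val).div
      (continuous_finsetSum _ fun W _ => (continuous_flagWeight _).comp continuous_subtype_val)
      fun x => (sum_flagWeight_pos x).ne'

lemma flagWeight_ne_zero_of_toBuilding {x : Realization (nonSpanningComplex F V)}
    {W : ProperSubspace F V} (h : (toBuilding F V x).1 W ≠ 0) : flagWeight x.1 W.1 ≠ 0 :=
  (div_ne_zero_iff.mp h).1

lemma isEquivariant_toBuilding :
    IsEquivariant (LinearMap.GeneralLinearGroup F V) (toBuilding F V) := by
  intro g x
  apply Subtype.ext
  funext W
  have h : ∀ W : ProperSubspace F V, flagWeight (g • x).1 W.1 = flagWeight x.1 (g⁻¹ • W).1 :=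
    fun W => flagWeight_smul g⁻¹ x.1 W.1
  change flagWeight (g • x).1 W.1 / (∑ W : ProperSubspace F V, flagWeight (g • x).1 W.1) =
    flagWeight x.1 (g⁻¹ • W).1 / ∑ W : ProperSubspace F V, flagWeight x.1 W.1
  simp only [h]
  congr 1
  exact Fintype.sum_equiv (MulAction.toPerm g⁻¹) _ _ fun _ => rfl

open Classical in
/-- The nonzero vectors of a subspace. -/
noncomputable def nonzeroVectors (W : Submodule F V) : Finset (NonzeroVector V) :=
  Finset.univ.filter fun v => v.val ∈ W

lemma mem_nonzeroVectors {W : Submodule F V} {v : NonzeroVector V} :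
    v ∈ nonzeroVectors W ↔ v.val ∈ W := by
  simp [nonzeroVectors]

lemma nonzeroVectors_mem_faces {W : Submodule F V} (h : (nonzeroVectors W).Nonempty)
    (hW : W ≠ ⊤) : nonzeroVectors W ∈ (nonSpanningComplex F V).faces := by
  refine ⟨h, fun hs => hW (top_le_iff.mp (hs ▸ Submodule.span_le.mpr ?_))⟩
  rintro _ ⟨v, hv, rfl⟩
  exact mem_nonzeroVectors.mp hv

lemma nonzeroVectors_nonempty (W : ProperSubspace F V) : (nonzeroVectors W.1).Nonempty := by
  obtain ⟨u, hu, -⟩ := exists_nonzeroVector_notMem (fun h => W.2.1 (le_bot_iff.mp h))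
  exact ⟨u, mem_nonzeroVectors.mpr hu⟩

lemma card_nonzeroVectors_smul (g : LinearMap.GeneralLinearGroup F V) (W : ProperSubspace F V) :
    (nonzeroVectors (g • W).1).card = (nonzeroVectors W.1).card := by
  refine (Finset.card_equiv (MulAction.toPerm g) fun v => ?_).symm
  rw [mem_nonzeroVectors, mem_nonzeroVectors]
  exact (g.toLinearEquiv.injective.mem_set_image (s := (W.1 : Set V)) (a := v.val)).symm

open Classical in
/-- The average of the uniform distributions on the nonzero vectors of `W`, with weights `y W`. -/
noncomputable def averageDistribution (y : ProperSubspace F V → ℝ) (v : NonzeroVector V) : ℝ :=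
  ∑ W : ProperSubspace F V, if v.val ∈ W.1 then y W / (nonzeroVectors W.1).card else 0

lemma averageDistribution_nonneg {y : ProperSubspace F V → ℝ} (hy : ∀ W, 0 ≤ y W)
    (v : NonzeroVector V) : 0 ≤ averageDistribution y v := by
  classical
  refine Finset.sum_nonneg fun W _ => ?_
  split_ifs
  · exact div_nonneg (hy W) (Nat.cast_nonneg _)
  · exact le_rfl

lemma exists_mem_of_averageDistribution_ne_zero {y : ProperSubspace F V → ℝ}
    {v : NonzeroVector V} (h : averageDistribution y v ≠ 0) : ∃ W, y W ≠ 0 ∧ v.val ∈ W.1 := by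
  classical
  obtain ⟨W, -, hW⟩ := Finset.exists_ne_zero_of_sum_ne_zero h
  obtain ⟨hv, hW⟩ := ite_ne_right_iff.mp hW
  exact ⟨W, (div_ne_zero_iff.mp hW).1, hv⟩

lemma sum_averageDistribution (y : ProperSubspace F V → ℝ) :
    ∑ v, averageDistribution y v = ∑ W, y W := by
  classical
  unfold averageDistribution
  rw [Finset.sum_comm]
  refine Finset.sum_congr rfl fun W _ => ?_
  have hc : ((nonzeroVectors W.1).card : ℝ) ≠ 0 :=
    Nat.cast_ne_zero.mpr (nonzeroVectors_nonempty W).card_pos.ne'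
  rw [← Finset.sum_filter]
  change ∑ v ∈ nonzeroVectors W.1, _ = _
  rw [Finset.sum_const, nsmul_eq_mul, mul_div_cancel₀ _ hc]

lemma continuous_averageDistribution (v : NonzeroVector V) :
    Continuous fun y : ProperSubspace F V → ℝ => averageDistribution y v := by
  classical
  unfold averageDistribution
  refine continuous_finsetSum _ fun W _ => ?_
  split_ifs <;> fun_prop

variable (F V) in
/-- The map sending the vertex `W` of the building to the barycentre of its nonzero vectors. -/
noncomputable def ofBuilding :
    C(Realization (building F V), Realization (nonSpanningComplex F V)) where
  toFun y := Realization.mk (averageDistribution y.1) (averageDistribution_nonneg y.2.1)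
    ((sum_averageDistribution y.1).trans y.sum_eq_one) <| by
      obtain ⟨s, hs, hsupp, -⟩ := y.2.2
      -- The largest member of the flag contains all the others, hence every vector that receives
      -- mass.
      obtain ⟨W, hW⟩ := s.exists_maximal hs.1
      refine ⟨nonzeroVectors W.1, nonzeroVectors_mem_faces (nonzeroVectors_nonempty W) W.2.2,
        fun v hv => ?_⟩
      obtain ⟨U, hU, hvU⟩ := exists_mem_of_averageDistribution_ne_zero hv
      have hUs : U ∈ s := Finset.mem_coe.mp (hsupp ▸ Function.mem_support.mpr hU)
      have hle : U ≤ W := (hs.2.total hUs hW.1).elim id fun h => hW.2 hUs h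
      exact mem_nonzeroVectors.mpr (hle hvU)
  continuous_toFun := continuous_induced_rng.mpr <| continuous_pi fun v =>
    (continuous_averageDistribution v).comp continuous_subtype_val

lemma coe_ofBuilding (y : Realization (building F V)) :
    (ofBuilding F V y).1 = averageDistribution y.1 := rfl

lemma isEquivariant_ofBuilding :
    IsEquivariant (LinearMap.GeneralLinearGroup F V) (ofBuilding F V) := by
  classical
  intro g y
  apply Subtype.ext
  funext v
  change averageDistribution (fun W => y.1 (g⁻¹ • W)) v = averageDistribution y.1 (g⁻¹ • v)
  unfold averageDistribution
  refine Fintype.sum_equiv (MulAction.toPerm g⁻¹) _ _ fun W => ?_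
  have hmem : (g⁻¹ • v).val ∈ (g⁻¹ • W).1 ↔ v.val ∈ W.1 :=
    (g⁻¹).toLinearEquiv.injective.mem_set_image (s := (W.1 : Set V))
  simp only [MulAction.toPerm_apply, hmem, card_nonzeroVectors_smul]

/-- If the weights are supported on a chain, the superlevel sets of the average distribution are
compatible with that chain. -/
lemma le_or_le_of_flagWeight_averageDistribution_ne_zero {y : ProperSubspace F V → ℝ}
    (hy : ∀ W, 0 ≤ y W) (hchain : IsChain (· ≤ ·) (Function.support y))
    {W U : ProperSubspace F V} (hW : flagWeight (averageDistribution y) W.1 ≠ 0) (hU : y U ≠ 0) :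
    W ≤ U ∨ U ≤ W := by
  classical
  rw [flagWeight_ne_zero_iff] at hW
  by_contra hc
  rw [not_or] at hc
  -- Here v is in W but not U, and u in U but not W. Any T in the chain containing v is not inside
  -- U, so it contains U and hence u. Thus u gets at least the mass of v, contradicting the gap.
  obtain ⟨v, hv, hvU, hvx⟩ := hW (W.1 ⊓ U.1) (inf_lt_left.mpr hc.1)
  obtain ⟨u, hu, huW⟩ := exists_nonzeroVector_notMem hc.2
  refine (hvx u huW).not_ge (Finset.sum_le_sum fun T _ => ?_)
  have hT0 : 0 ≤ y T / (nonzeroVectors T.1).card := div_nonneg (hy T) (Nat.cast_nonneg _)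
  by_cases hvT : v.val ∈ T.1
  · by_cases hT : y T = 0
    · simp [hT]
    · have hle : U ≤ T := (hchain.total hU hT).resolve_right fun h => hvU ⟨hv, h hvT⟩
      rw [if_pos hvT, if_pos (hle hu)]
  · rw [if_neg hvT]
    split_ifs
    · exact hT0
    · exact le_rfl

end Maps

/-! ### The equivariant homotopy equivalence -/

variable (F V) in
theorem equivariantlyHomotopyEquivalent_nonSpanningComplex_building :
    EquivariantlyHomotopyEquivalent (LinearMap.GeneralLinearGroup F V)
      (Realization (nonSpanningComplex F V)) (Realization (building F V)) := by
  classical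
  refine ⟨toBuilding F V, ofBuilding F V, isEquivariant_toBuilding, isEquivariant_ofBuilding,
    homotopicWith_of_common_face _ _ ?_ (fun _ _ => rfl) fun x => ?_,
    homotopicWith_of_common_face _ _ ?_ (fun _ _ => rfl) fun y => ?_⟩
  · intro g x
    exact (congrArg _ (isEquivariant_toBuilding g x)).trans (isEquivariant_ofBuilding g _)
  · have hsupp : ∀ v, x.1 v ≠ 0 →
        v ∈ nonzeroVectors (Submodule.span F (NonzeroVector.val '' Function.support x.1)) :=
      fun v hv => mem_nonzeroVectors.mpr (Submodule.subset_span ⟨v, hv, rfl⟩)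
    obtain ⟨v, -, hv⟩ := Finset.exists_ne_zero_of_sum_ne_zero (x.sum_eq_one.trans_ne one_ne_zero)
    refine ⟨_, nonzeroVectors_mem_faces ⟨v, hsupp v hv⟩ (span_support_ne_top x), ?_⟩
    rintro v (hv | hv)
    · obtain ⟨W, hW, hvW⟩ := exists_mem_of_averageDistribution_ne_zero hv
      exact mem_nonzeroVectors.mpr (le_span_support_of_flagWeight_ne_zero x.2.1 W.2.2
        (flagWeight_ne_zero_of_toBuilding hW) hvW)
    · exact hsupp v hv
  · intro g y
    exact (congrArg _ (isEquivariant_ofBuilding g y)).trans (isEquivariant_toBuilding g _)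
  · obtain ⟨s, hs, hsupp, -⟩ := y.2.2
    have hchain : IsChain (· ≤ ·) (Function.support y.1) := hsupp ▸ hs.2
    obtain ⟨W, -, hW⟩ := Finset.exists_ne_zero_of_sum_ne_zero (y.sum_eq_one.trans_ne one_ne_zero)
    have hz : ∀ W, (toBuilding F V (ofBuilding F V y)).1 W ≠ 0 →
        flagWeight (averageDistribution y.1) W.1 ≠ 0 := fun W hW =>
      coe_ofBuilding y ▸ flagWeight_ne_zero_of_toBuilding hW
    have hzy : ∀ W U, flagWeight (averageDistribution y.1) W.1 ≠ 0 → y.1 U ≠ 0 → W ≤ U ∨ U ≤ W :=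
      fun W U => le_or_le_of_flagWeight_averageDistribution_ne_zero y.2.1 hchain
    -- The common face is the union of the flag of superlevel spans and the support of y.
    refine ⟨Finset.univ.filter fun W =>
      flagWeight (averageDistribution y.1) W.1 ≠ 0 ∨ y.1 W ≠ 0,
      ⟨⟨W, ?_⟩, ?_⟩, fun W hW => ?_⟩
    · exact Finset.mem_filter.mpr ⟨Finset.mem_univ W, Or.inr hW⟩
    · intro W hW U hU _
      rw [Finset.mem_coe, Finset.mem_filter] at hW hU
      rcases hW.2 with hW | hW <;> rcases hU.2 with hU | hU
      · exact le_or_le_of_flagWeight_ne_zero hW hU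
      · exact hzy W U hW hU
      · exact (hzy U W hU hW).symm
      · exact hchain.total hW hU
    · exact Finset.mem_filter.mpr ⟨Finset.mem_univ W, hW.imp_left (hz W)⟩

end TitsBuilding

theorem mainTheorem9 (n : ℕ) (V : Type*) [AddCommGroup V] [Module (ZMod 2) V] [Finite V]
    (hV : Module.finrank (ZMod 2) V = n) :
    TitsBuilding.EquivariantlyHomotopyEquivalent (LinearMap.GeneralLinearGroup (ZMod 2) V)
      (TitsBuilding.Realization (TitsBuilding.nonSpanningComplex (ZMod 2) V))
      (TitsBuilding.Realization (TitsBuilding.building (ZMod 2) V)) :=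
  TitsBuilding.equivariantlyHomotopyEquivalent_nonSpanningComplex_building (ZMod 2) V
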